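/- Let $n\ge 0$ be an integer and let $\Gamma\subset\mathbb{R}^n$ be a symmetric cone containing the positive cone: $\Gamma$ is invariant under multiplication by positive scalars and under permutations of the coordinates, and it contains every vector with all entries positive. Put $-\Gamma=\{-A : A\in\Gamma\}$ and let $F:\Gamma\cup(-\Gamma)\to\mathbb{R}$ be symmetric (invariant under permutations of its arguments), odd ($F(-\kappa)=-F(\kappa)$), and non-decreasing (if $\kappa,\lambda\in\Gamma\cup(-\Gamma)$ and $\kappa_i\le\lambda_i$ for all $i$, then $F(\kappa)\le F(\lambda)$). Let $M_1,M_2$ be compact smooth $n$-dimensional manifolds without boundary, let $0<T\le\infty$, and for $i=1,2$ let $X_i:M_i\times[0,T)\to\mathbb{R}^{n+1}$ be a solution of $$\frac{\partial X}{\partial t}=-F\,\nu .$$ This means that $X_i$ and $\partial X_i/\partial t$ (one-sided at $t=0$) are continuous on $M_i\times[0,T)$, that every $X_i(\cdot,t)$ is an immersion of class $C^2$, and that at every $(x,t)$, for a choice of unit normal $\nu$ to $X_i(\cdot,t)$ at $x$, the vector $\kappa=(\kappa_1,\dots,\kappa_n)$ of principal curvatures with respect to $\nu$ lies in $\Gamma\cup(-\Gamma)$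 and $\frac{\partial X_i}{\partial t}(x,t)=-F(\kappa)\,\nu$. Here the principal curvatures are the eigenvalues, relative to the induced metric, of the second fundamental form $h(v,w)=-\langle \partial_v\partial_w X_i,\nu\rangle$ (so round spheres have positive principal curvatures with respect to the outward normal); since $F$ is odd, the equation does not depend on the choice of $\nu$. Suppose that $X_1(M_1,0)\cap X_2(M_2,0)=\emptyset$. Then the distance $$\operatorname{dist}\bigl(X_1(M_1,t),X_2(M_2,t)\bigr)=\inf\{\|X_1(x,t)-X_2(y,t)\| : x\in M_1,\ y\in M_2\}$$ is a non-decreasing function of $t\in[0,T)$, and in particular $X_1(M_1,t)\cap X_2(M_2,t)=\emptyset$ for every $t\in[0,T)$. -/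

import Mathlib

open scoped Manifold ContDiff

namespace CurvatureFlow

noncomputable section

/-- The half-open time interval `[0, T)`, where `T = ∞` is allowed. -/
def timeInterval (T : EReal) : Set ℝ := {t : ℝ | 0 ≤ t ∧ (t : EReal) < T}

/-- The distance between two subsets of Euclidean space: the infimum of the distances between
a point of the first and a point of the second. -/
def setDist {E : Type*} [PseudoMetricSpace E] (A B : Set E) : ℝ :=
  sInf (Set.image2 dist A B)

/-- A symmetric cone in `ℝⁿ` which contains the positive cone. Neither convexity nor openness is
required. -/
structure IsSymmetricCone {n : ℕ} (Γ : Set (Fin n → ℝ)) : Prop where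
  smul_mem : ∀ c : ℝ, 0 < c → ∀ κ ∈ Γ, c • κ ∈ Γ
  perm_mem : ∀ σ : Equiv.Perm (Fin n), ∀ κ ∈ Γ, κ ∘ σ ∈ Γ
  pos_mem : ∀ κ : Fin n → ℝ, (∀ i, 0 < κ i) → κ ∈ Γ

/-- `F` is an odd, non-decreasing, symmetric function on `D` (values of `F` off `D` are
irrelevant). Non-decreasing refers to the componentwise order on all of `D`. -/
structure IsOddMonotoneSymmetric {n : ℕ} (D : Set (Fin n → ℝ)) (F : (Fin n → ℝ) → ℝ) :
    Prop where
  odd : ∀ κ ∈ D, F (-κ) = -F κ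
  mono : MonotoneOn F D
  symm : ∀ σ : Equiv.Perm (Fin n), ∀ κ ∈ D, F (κ ∘ σ) = F κ

section Hypersurface

variable {n : ℕ} {M : Type*} [TopologicalSpace M] [ChartedSpace (EuclideanSpace ℝ (Fin n)) M]

/-- The map `f : M → ℝⁿ⁺¹` read in the preferred chart of `M` at `x`. -/
def localRep (f : M → EuclideanSpace ℝ (Fin (n + 1))) (x : M) :
    EuclideanSpace ℝ (Fin n) → EuclideanSpace ℝ (Fin (n + 1)) :=
  f ∘ (extChartAt (𝓡 n) x).symm

/-- The first derivative at `x` of `f` in the preferred chart at `x`. -/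
def localDeriv (f : M → EuclideanSpace ℝ (Fin (n + 1))) (x : M) :
    EuclideanSpace ℝ (Fin n) →L[ℝ] EuclideanSpace ℝ (Fin (n + 1)) :=
  fderiv ℝ (localRep f x) (extChartAt (𝓡 n) x x)

/-- The first fundamental form (induced metric) of `f` at `x`: `g(v, w) = ⟨∂ᵥf, ∂_w f⟩`. -/
def firstForm (f : M → EuclideanSpace ℝ (Fin (n + 1))) (x : M)
    (v w : EuclideanSpace ℝ (Fin n)) : ℝ :=
  inner ℝ (localDeriv f x v) (localDeriv f x w)

/-- The second fundamental form of `f` at `x` with respect to the unit normal `ν`, with the sign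
for which a sphere has positive curvature with respect to its outward normal:
`h(v, w) = -⟨∂ᵥ∂_w f, ν⟩`. -/
def secondForm (f : M → EuclideanSpace ℝ (Fin (n + 1))) (ν : EuclideanSpace ℝ (Fin (n + 1)))
    (x : M) (v w : EuclideanSpace ℝ (Fin n)) : ℝ :=
  -inner ℝ (fderiv ℝ (fderiv ℝ (localRep f x)) (extChartAt (𝓡 n) x x) v w) ν

/-- `ν` is a unit normal vector at the point `x` of the hypersurface parametrized by `f`. -/
def IsUnitNormal (f : M → EuclideanSpace ℝ (Fin (n + 1))) (x : M)
    (ν : EuclideanSpace ℝ (Fin (n + 1))) : Prop :=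
  ‖ν‖ = 1 ∧ ∀ v, inner ℝ (localDeriv f x v) ν = 0

/-- `κ` lists the principal curvatures of `f` at `x` with respect to `ν`, with multiplicity and in
some order: there is a basis of the tangent space, orthonormal for the first fundamental form,
that diagonalizes the second fundamental form with diagonal entries `κ`. -/
def IsPrincipalCurvatures (f : M → EuclideanSpace ℝ (Fin (n + 1)))
    (ν : EuclideanSpace ℝ (Fin (n + 1))) (x : M) (κ : Fin n → ℝ) : Prop :=
  ∃ e : Module.Basis (Fin n) ℝ (EuclideanSpace ℝ (Fin n)),
    (∀ i j, firstForm f x (e i) (e j) = if i = j then 1 else 0) ∧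
    (∀ i j, secondForm f ν x (e i) (e j) = if i = j then κ i else 0)

/-- `X : M × [0, T) → ℝⁿ⁺¹` is a classical solution of `∂X/∂t = -F ν`, where `F` is evaluated at
the principal curvatures, which are required to lie in `D`, the domain of `F`.
Each `X(·, t)` is an immersion (not necessarily injective) of class `C²`, and `∂X/∂t` (one-sided
at `t = 0`) is continuous on `M × [0, T)`; in particular all `C^∞` solutions are covered.
`ν(x, t)` is a choice of unit normal at each point. As `F` is odd in the application, the equation
is unaffected by changing the sign of `ν` at any point, so no continuity of `ν` (that is, no
orientability of `M`) is demanded. -/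
structure IsSolution (D : Set (Fin n → ℝ)) (F : (Fin n → ℝ) → ℝ) (T : EReal)
    (X : M → ℝ → EuclideanSpace ℝ (Fin (n + 1)))
    (ν : M → ℝ → EuclideanSpace ℝ (Fin (n + 1))) : Prop where
  contMDiff : ∀ t ∈ timeInterval T,
    ContMDiff (𝓡 n) 𝓘(ℝ, EuclideanSpace ℝ (Fin (n + 1))) 2 (fun x => X x t)
  immersion : ∀ t ∈ timeInterval T, ∀ x : M,
    Function.Injective (mfderiv (𝓡 n) 𝓘(ℝ, EuclideanSpace ℝ (Fin (n + 1))) (fun y => X y t) x)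
  continuousOn : ContinuousOn (fun p : M × ℝ => X p.1 p.2) (Set.univ ×ˢ timeInterval T)
  continuousOn_velocity :
    ContinuousOn (fun p : M × ℝ => derivWithin (X p.1) (timeInterval T) p.2)
      (Set.univ ×ˢ timeInterval T)
  isUnitNormal : ∀ t ∈ timeInterval T, ∀ x : M, IsUnitNormal (fun y => X y t) x (ν x t)
  flow : ∀ t ∈ timeInterval T, ∀ x : M, ∃ κ ∈ D,
    IsPrincipalCurvatures (fun y => X y t) (ν x t) x κ ∧
    HasDerivWithinAt (X x) (-(F κ • ν x t)) (timeInterval T) t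

end Hypersurface

end

end CurvatureFlow

/- At a pair of points realising the distance `r > 0` at time `t`, the vector `u = (X₁ - X₂) / r` is
a unit normal of both hypersurfaces, and both tangent spaces are `uᗮ`. Moving the two points with
equal tangent vectors, the second variation of the squared distance gives `h₁ ≤ h₂` on `uᗮ`, hence
(Weyl) the increasingly ordered principal curvatures satisfy `κ₁ ≤ κ₂`. So `F κ₁ ≤ F κ₂`, and the
squared distance of this pair has time derivative `2 r (F κ₂ - F κ₁) ≥ 0`.

The minimum over all pairs is therefore non-decreasing: a pair that is closest at time `t` bounds
the minimum from above at earlier times, so the left difference quotients of the minimum at `t`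
have nonnegative lower limit. -/

namespace CurvatureFlow

open Set Filter Topology Module
open scoped RealInnerProductSpace

section LeftDini

theorem le_of_frequently_lt_slope_left {f : ℝ → ℝ} {a b : ℝ} (hab : a ≤ b)
    (hf : ContinuousOn f (Icc a b))
    (hslope : ∀ t ∈ Ioc a b, ∀ r < 0, ∃ᶠ z in 𝓝[<] t, r < slope f t z) : f a ≤ f b := by
  -- Reflecting time turns left difference quotients into the right ones used in Mathlib.
  have hreflect : ContinuousOn (fun s => f (-s)) (Icc (-b) (-a)) :=
    hf.comp continuousOn_neg fun s hs => ⟨le_neg.1 hs.2, neg_le.1 hs.1⟩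
  have hbound : ∀ s ∈ Ico (-b) (-a), ∀ r, 0 < r →
      ∃ᶠ z in 𝓝[>] s, slope (fun s => f (-s)) s z < r := by
    intro s hs r hr
    have hleft := hslope (-s) ⟨lt_neg.1 hs.2, neg_le.1 hs.1⟩ (-r) (neg_lt_zero.2 hr)
    refine (tendsto_neg_nhdsLT_neg (a := s)).frequently (hleft.mono fun z hz => ?_)
    have hslope_neg : slope (fun s => f (-s)) s (-z) = -slope f (-s) z := by
      rw [slope_def_field, slope_def_field, neg_neg, ← div_neg]
      ring
    rw [hslope_neg]
    exact neg_lt.1 hz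
  have hle := image_le_of_liminf_slope_right_le_deriv_boundary hreflect (B := fun _ => f b)
    (B' := fun _ => 0) (by rw [neg_neg]) continuousOn_const
    (fun _ _ => hasDerivWithinAt_const _ _ _) hbound (right_mem_Icc.2 (neg_le_neg hab))
  rwa [neg_neg] at hle

theorem exists_le_of_deriv_nonneg_at_min {K : Type*} [TopologicalSpace K] [CompactSpace K]
    {q : K → ℝ → ℝ} {a b : ℝ} (hab : a ≤ b)
    (hq : ContinuousOn (fun p : K × ℝ => q p.1 p.2) (univ ×ˢ Icc a b))
    (hmin : ∀ t ∈ Ioc a b, ∀ p, (∀ p', q p t ≤ q p' t) →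
      ∃ d, 0 ≤ d ∧ HasDerivWithinAt (q p) d (Iio t) t) (p : K) :
    ∃ p', q p' a ≤ q p b := by
  have : Nonempty K := ⟨p⟩
  have hslice : ∀ t ∈ Icc a b, Continuous fun p => q p t := fun t ht =>
    hq.comp_continuous (by fun_prop : Continuous fun p : K => (p, t)) fun p => ⟨mem_univ _, ht⟩
  let m : ℝ → ℝ := fun t => sInf ((fun p => q p t) '' univ)
  have hm_attained : ∀ t ∈ Icc a b, ∃ p, q p t = m t ∧ ∀ p', q p t ≤ q p' t := by
    intro t ht
    obtain ⟨p, -, hp, hp_le⟩ := isCompact_univ.exists_sInf_image_eq_and_le univ_nonempty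
      (hslice t ht).continuousOn
    exact ⟨p, hp.symm, fun p' => hp_le p' (mem_univ _)⟩
  have hm_le : ∀ t ∈ Icc a b, ∀ p, m t ≤ q p t := by
    intro t ht p
    obtain ⟨p₀, hp₀, hp₀_le⟩ := hm_attained t ht
    exact hp₀ ▸ hp₀_le p
  have hm_cont : ContinuousOn m (Icc a b) := by
    rw [continuousOn_iff_continuous_domRestrict]
    refine IsCompact.continuous_sInf (f := fun (t : Icc a b) p => q p t) isCompact_univ ?_
    exact hq.comp_continuous (by fun_prop : Continuous fun z : Icc a b × K => (z.2, (z.1 : ℝ)))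
      fun z => ⟨mem_univ _, z.1.2⟩
  have hm_slope : ∀ t ∈ Ioc a b, ∀ r < 0, ∃ᶠ z in 𝓝[<] t, r < slope m t z := by
    intro t ht r hr
    obtain ⟨p₀, hp₀, hp₀_le⟩ := hm_attained t (Ioc_subset_Icc_self ht)
    obtain ⟨d, hd, hderiv⟩ := hmin t ht p₀ hp₀_le
    have hslope : Tendsto (slope (q p₀) t) (𝓝[<] t) (𝓝 d) :=
      (hasDerivWithinAt_iff_tendsto_slope' self_notMem_Iio).1 hderiv
    refine Eventually.frequently ?_
    filter_upwards [hslope.eventually (lt_mem_nhds (hr.trans_le hd)), Ioo_mem_nhdsLT ht.1]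
      with z hz hzt
    refine hz.trans_le ?_
    rw [slope_def_field, slope_def_field, hp₀]
    exact div_le_div_of_nonpos_of_le (sub_neg.2 hzt.2).le
      (sub_le_sub_right (hm_le z ⟨hzt.1.le, hzt.2.le.trans ht.2⟩ p₀) _)
  obtain ⟨p', hp', -⟩ := hm_attained a (left_mem_Icc.2 hab)
  exact ⟨p', hp'.trans_le ((le_of_frequently_lt_slope_left hab hm_cont hm_slope).trans
    (hm_le b (right_mem_Icc.2 hab) p))⟩

end LeftDini

section Weyl

theorem exists_ne_zero_forall_inner_eq_zero {𝕜 V ι : Type*} [RCLike 𝕜] [NormedAddCommGroup V]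
    [InnerProductSpace 𝕜 V] [Fintype ι] (c : ι → V) (hc : Fintype.card ι < finrank 𝕜 V) :
    ∃ v ≠ 0, ∀ i, inner 𝕜 (c i) v = 0 := by
  have : FiniteDimensional 𝕜 V := .of_finrank_pos (Nat.zero_lt_of_lt hc)
  have hker : LinearMap.ker (LinearMap.pi fun i => innerₛₗ 𝕜 (c i)) ≠ ⊥ :=
    LinearMap.ker_ne_bot_of_finrank_lt (by rwa [finrank_fintype_fun_eq_card])
  obtain ⟨v, hv, hv0⟩ := Submodule.exists_mem_ne_zero_of_ne_bot hker
  exact ⟨v, hv0, congrFun hv⟩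

theorem eigenvalues_le_of_quadraticForm_le {V : Type*} [NormedAddCommGroup V]
    [InnerProductSpace ℝ V] {n : ℕ} (a b : OrthonormalBasis (Fin n) ℝ V) {κ μ : Fin n → ℝ}
    (hκ : Monotone κ) (hμ : Monotone μ)
    (h : ∀ v, ∑ i, κ i * ⟪a i, v⟫ ^ 2 ≤ ∑ i, μ i * ⟪b i, v⟫ ^ 2) : κ ≤ μ := by
  intro k
  -- The `n - 1` vectors `a i` with `i < k` and `b i` with `k < i` do not span, so some `v ≠ 0` is
  -- orthogonal to all of them.
  have hcard : Fintype.card {i // i ≠ k} < finrank ℝ V := by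
    rw [finrank_eq_card_basis a.toBasis]
    exact Fintype.card_subtype_lt (x := k) (by simp)
  obtain ⟨v, hv0, hv⟩ := exists_ne_zero_forall_inner_eq_zero (𝕜 := ℝ)
    (fun i : {i // i ≠ k} => if i < k then a i else b i) hcard
  have ha : ∀ i < k, ⟪a i, v⟫ = 0 := fun i hi => by simpa [hi] using hv ⟨i, hi.ne⟩
  have hb : ∀ i, k < i → ⟪b i, v⟫ = 0 := fun i hi => by simpa [hi.not_gt] using hv ⟨i, hi.ne'⟩
  have hκ_le : ∀ i, κ k * ⟪a i, v⟫ ^ 2 ≤ κ i * ⟪a i, v⟫ ^ 2 := fun i => by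
    rcases lt_or_ge i k with hi | hi
    · simp [ha i hi]
    · exact mul_le_mul_of_nonneg_right (hκ hi) (sq_nonneg _)
  have hμ_le : ∀ i, μ i * ⟪b i, v⟫ ^ 2 ≤ μ k * ⟪b i, v⟫ ^ 2 := fun i => by
    rcases lt_or_ge k i with hi | hi
    · simp [hb i hi]
    · exact mul_le_mul_of_nonneg_right (hμ hi) (sq_nonneg _)
  have hv_pos : 0 < ‖v‖ ^ 2 := pow_pos (norm_pos_iff.2 hv0) 2
  refine le_of_mul_le_mul_right ?_ hv_pos
  calc κ k * ‖v‖ ^ 2 = ∑ i, κ k * ⟪a i, v⟫ ^ 2 := by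
        rw [← a.sum_sq_inner_right, Finset.mul_sum]
    _ ≤ ∑ i, κ i * ⟪a i, v⟫ ^ 2 := Finset.sum_le_sum fun i _ => hκ_le i
    _ ≤ ∑ i, μ i * ⟪b i, v⟫ ^ 2 := h v
    _ ≤ ∑ i, μ k * ⟪b i, v⟫ ^ 2 := Finset.sum_le_sum fun i _ => hμ_le i
    _ = μ k * ‖v‖ ^ 2 := by rw [← b.sum_sq_inner_right, Finset.mul_sum]

end Weyl

section SecondVariation

theorem deriv_deriv_nonneg_of_isLocalMin {g : ℝ → ℝ} {t : ℝ} (hmin : IsLocalMin g t)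
    (hg : ContinuousAt g t) : 0 ≤ deriv (deriv g) t := by
  -- If it were negative, `t` would also be a local maximum, so `g` would be locally constant.
  by_contra! hneg
  have hmax := isLocalMax_of_deriv_deriv_neg hneg hmin.deriv_eq_zero hg
  have hconst : g =ᶠ[𝓝 t] fun _ => g t := by
    filter_upwards [hmin, hmax] with s hs_min hs_max using le_antisymm hs_max hs_min
  have hzero : deriv (deriv g) t = 0 := by
    simpa only [deriv_const', deriv_const] using hconst.deriv.deriv_eq
  exact hneg.ne hzero

theorem norm_sq_add_inner_nonneg_of_isLocalMin {E : Type*} [NormedAddCommGroup E]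
    [InnerProductSpace ℝ E] {G G' : ℝ → E} {G'' : E} {t : ℝ}
    (hG : ∀ᶠ s in 𝓝 t, HasDerivAt G (G' s) s) (hG' : HasDerivAt G' G'' t)
    (hmin : IsLocalMin (fun s => ‖G s‖ ^ 2) t) : 0 ≤ ‖G' t‖ ^ 2 + ⟪G t, G''⟫ := by
  have hfirst : deriv (fun s => ‖G s‖ ^ 2) =ᶠ[𝓝 t] fun s => 2 * ⟪G s, G' s⟫ :=
    hG.mono fun s hs => hs.norm_sq.deriv
  have hsecond : HasDerivAt (fun s => 2 * ⟪G s, G' s⟫) (2 * (⟪G t, G''⟫ + ⟪G' t, G' t⟫)) t :=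
    (hG.self_of_nhds.inner ℝ hG').const_mul 2
  have hnonneg := deriv_deriv_nonneg_of_isLocalMin hmin hG.self_of_nhds.norm_sq.continuousAt
  rw [hfirst.deriv_eq, hsecond.deriv, real_inner_self_eq_norm_sq] at hnonneg
  linarith

variable {V E : Type*} [NormedAddCommGroup V] [NormedSpace ℝ V] [NormedAddCommGroup E]
  [NormedSpace ℝ E] {f : V → E} {p : V}

theorem hasDerivAt_comp_add_smul {s : ℝ} {v : V} (hf : DifferentiableAt ℝ f (p + s • v)) :
    HasDerivAt (fun s : ℝ => f (p + s • v)) (fderiv ℝ f (p + s • v) v) s := by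
  have hline : HasDerivAt (fun s : ℝ => p + s • v) v s := by
    simpa only [one_smul, id] using ((hasDerivAt_id s).smul_const v).const_add p
  exact hf.hasFDerivAt.comp_hasDerivAt s hline

theorem eventually_hasDerivAt_comp_add_smul (hf : ContDiffAt ℝ 2 f p) (v : V) :
    ∀ᶠ s in 𝓝 (0 : ℝ),
      HasDerivAt (fun s : ℝ => f (p + s • v)) (fderiv ℝ f (p + s • v) v) s := by
  have htendsto : Tendsto (fun s : ℝ => p + s • v) (𝓝 0) (𝓝 p) :=
    Continuous.tendsto' (by fun_prop) _ _ (by rw [zero_smul, add_zero])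
  filter_upwards [htendsto.eventually (hf.eventually (by simp))] with s hs
  exact hasDerivAt_comp_add_smul (hs.differentiableAt (by simp))

theorem hasDerivAt_fderiv_comp_add_smul (hf : ContDiffAt ℝ 2 f p) (v : V) :
    HasDerivAt (fun s : ℝ => fderiv ℝ f (p + s • v) v) (fderiv ℝ (fderiv ℝ f) p v v) 0 := by
  have hp : p + (0 : ℝ) • v = p := by rw [zero_smul, add_zero]
  have hdiff : DifferentiableAt ℝ (fderiv ℝ f) (p + (0 : ℝ) • v) := by
    rw [hp]
    exact (hf.fderiv_right (m := 1) (by norm_num)).differentiableAt (by simp)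
  simpa only [hp, map_zero, add_zero] using
    (hasDerivAt_comp_add_smul hdiff).clm_apply (hasDerivAt_const (0 : ℝ) v)

end SecondVariation

section Hypersurface

variable {n : ℕ} {M : Type*} [TopologicalSpace M] [ChartedSpace (EuclideanSpace ℝ (Fin n)) M]
  {f : M → EuclideanSpace ℝ (Fin (n + 1))} {x : M} {ν u : EuclideanSpace ℝ (Fin (n + 1))}
  {κ : Fin n → ℝ}

theorem localRep_extChartAt (f : M → EuclideanSpace ℝ (Fin (n + 1))) (x : M) :
    localRep f x (extChartAt (𝓡 n) x x) = f x := by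
  rw [localRep, Function.comp_apply, extChartAt_to_inv]

theorem contDiffAt_localRep {k : WithTop ℕ∞}
    (hf : ContMDiffAt (𝓡 n) 𝓘(ℝ, EuclideanSpace ℝ (Fin (n + 1))) k f x) :
    ContDiffAt ℝ k (localRep f x) (extChartAt (𝓡 n) x x) := by
  simpa only [extChartAt_model_space_eq_id, PartialEquiv.refl_coe, Function.id_comp,
    modelWithCornersSelf_coe, range_id, contDiffWithinAt_univ, localRep] using
    (contMDiffAt_iff.1 hf).2

theorem secondForm_sum_smul {e : Fin n → EuclideanSpace ℝ (Fin n)}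
    (he : ∀ i j, secondForm f ν x (e i) (e j) = if i = j then κ i else 0) (c : Fin n → ℝ) :
    secondForm f ν x (∑ i, c i • e i) (∑ i, c i • e i) = ∑ i, κ i * c i ^ 2 := by
  have hexpand : secondForm f ν x (∑ i, c i • e i) (∑ j, c j • e j) =
      ∑ j, ∑ i, c j * (c i * secondForm f ν x (e i) (e j)) := by
    simp only [secondForm, map_sum, map_smul, sum_apply, smul_apply, sum_inner,
      real_inner_smul_left, Finset.mul_sum, mul_neg, Finset.sum_neg_distrib]
  simp only [hexpand, he, mul_ite, mul_zero, Finset.sum_ite_eq', Finset.mem_univ, if_true]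
  exact Finset.sum_congr rfl fun i _ => by ring

theorem IsPrincipalCurvatures.neg (hκ : IsPrincipalCurvatures f ν x κ) :
    IsPrincipalCurvatures f (-ν) x (-κ) := by
  obtain ⟨e, hfirst, hsecond⟩ := hκ
  refine ⟨e, hfirst, fun i j => ?_⟩
  have hneg : secondForm f (-ν) x (e i) (e j) = -secondForm f ν x (e i) (e j) := by
    rw [secondForm, secondForm, inner_neg_right]
  rw [hneg, hsecond, neg_ite, neg_zero, Pi.neg_apply]

theorem IsPrincipalCurvatures.comp_perm (hκ : IsPrincipalCurvatures f ν x κ)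
    (σ : Equiv.Perm (Fin n)) : IsPrincipalCurvatures f ν x (κ ∘ σ) := by
  obtain ⟨e, hfirst, hsecond⟩ := hκ
  refine ⟨e.reindex σ.symm, fun i j => ?_, fun i j => ?_⟩
  · simpa only [Basis.reindex_apply, Equiv.symm_symm, σ.injective.eq_iff] using
      hfirst (σ i) (σ j)
  · simpa only [Basis.reindex_apply, Equiv.symm_symm, Function.comp_apply, σ.injective.eq_iff]
      using hsecond (σ i) (σ j)

/-- The basis is the image under the differential of a basis of principal directions. -/
theorem IsPrincipalCurvatures.exists_orthonormalBasis (hν : IsUnitNormal f x ν)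
    (hκ : IsPrincipalCurvatures f ν x κ) :
    ∃ a : OrthonormalBasis (Fin n) ℝ (ℝ ∙ ν)ᗮ, ∀ w : (ℝ ∙ ν)ᗮ, ∃ v,
      localDeriv f x v = w ∧ secondForm f ν x v v = ∑ i, κ i * ⟪a i, w⟫ ^ 2 := by
  obtain ⟨e, hfirst, hsecond⟩ := hκ
  let a₀ : Fin n → (ℝ ∙ ν)ᗮ := fun i =>
    ⟨localDeriv f x (e i), Submodule.mem_orthogonal_singleton_iff_inner_left.2 (hν.2 _)⟩
  have ha₀ : Orthonormal ℝ a₀ := orthonormal_iff_ite.2 hfirst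
  have hν0 : ν ≠ 0 := norm_ne_zero_iff.1 (hν.1 ▸ one_ne_zero)
  have hfinrank : finrank ℝ (ℝ ∙ ν)ᗮ = n := by
    have : Fact (finrank ℝ (EuclideanSpace ℝ (Fin (n + 1))) = n + 1) := ⟨finrank_euclideanSpace_fin⟩
    exact Submodule.finrank_orthogonal_span_singleton hν0
  have hspan := ha₀.linearIndependent.span_eq_top_of_card_eq_finrank'
    ((Fintype.card_fin n).trans hfinrank.symm)
  let a := OrthonormalBasis.mk ha₀ hspan.ge
  refine ⟨a, fun w => ⟨∑ i, ⟪a i, w⟫ • e i, ?_, secondForm_sum_smul hsecond _⟩⟩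
  have hw : ∑ i, ⟪a i, w⟫ • a₀ i = w := by
    simpa only [a, OrthonormalBasis.coe_mk] using a.sum_repr' w
  calc localDeriv f x (∑ i, ⟪a i, w⟫ • e i) = ↑(∑ i, ⟪a i, w⟫ • a₀ i) := by
        simp only [map_sum, map_smul, Submodule.coe_sum, Submodule.coe_smul, a₀]
    _ = w := congrArg _ hw

theorem IsUnitNormal.eq_or_eq_neg (hκ : IsPrincipalCurvatures f ν x κ) (hν : IsUnitNormal f x ν)
    (hu : IsUnitNormal f x u) : u = ν ∨ u = -ν := by
  obtain ⟨a, ha⟩ := hκ.exists_orthonormalBasis hν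
  have hu_mem : u ∈ (ℝ ∙ ν)ᗮᗮ := by
    refine (Submodule.mem_orthogonal _ _).2 fun w hw => ?_
    obtain ⟨v, hv, -⟩ := ha ⟨w, hw⟩
    rw [← hu.2 v, hv]
  rw [Submodule.orthogonal_orthogonal, Submodule.mem_span_singleton] at hu_mem
  obtain ⟨c, rfl⟩ := hu_mem
  have hc : |c| = 1 := by
    simpa only [norm_smul, hν.1, mul_one, Real.norm_eq_abs] using hu.1
  rcases eq_or_eq_neg_of_abs_eq hc with rfl | rfl
  · exact .inl (one_smul ℝ ν)
  · exact .inr (neg_one_smul ℝ ν)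

end Hypersurface

section ClosestPair

/-- The distance between the images of `f` and `g` is attained at the parameters `x` and `y`.
As the hypersurfaces need not be embedded, this is a condition on parameters and not on points. -/
def IsClosestPair {α β E : Type*} [PseudoMetricSpace E] (f : α → E) (g : β → E) (x : α)
    (y : β) : Prop :=
  ∀ x' y', dist (f x) (g y) ≤ dist (f x') (g y')

theorem IsClosestPair.symm {α β E : Type*} [PseudoMetricSpace E] {f : α → E} {g : β → E} {x : α}
    {y : β} (h : IsClosestPair f g x y) : IsClosestPair g f y x := fun y' x' => by
  simpa only [dist_comm] using h x' y'

variable {n : ℕ} {M₁ M₂ : Type*}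
  [TopologicalSpace M₁] [ChartedSpace (EuclideanSpace ℝ (Fin n)) M₁]
  [TopologicalSpace M₂] [ChartedSpace (EuclideanSpace ℝ (Fin n)) M₂]
  {f₁ : M₁ → EuclideanSpace ℝ (Fin (n + 1))} {f₂ : M₂ → EuclideanSpace ℝ (Fin (n + 1))}
  {x : M₁} {y : M₂} {u : EuclideanSpace ℝ (Fin (n + 1))} {r : ℝ}

theorem IsClosestPair.isUnitNormal_left {N : Type*} {g : N → EuclideanSpace ℝ (Fin (n + 1))}
    {z : N} (hmin : IsClosestPair f₁ g x z)
    (hf₁ : DifferentiableAt ℝ (localRep f₁ x) (extChartAt (𝓡 n) x x)) (hr : r ≠ 0)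
    (hu : ‖u‖ = 1) (hru : f₁ x - g z = r • u) : IsUnitNormal f₁ x u := by
  refine ⟨hu, fun v => ?_⟩
  have hlocalMin : IsLocalMin (fun p => ‖localRep f₁ x p - g z‖ ^ 2) (extChartAt (𝓡 n) x x) :=
    Eventually.of_forall fun p => by
      simp only [localRep_extChartAt, ← dist_eq_norm]
      exact pow_le_pow_left₀ dist_nonneg (hmin _ z) 2
  have hzero := congrArg (· v)
    (hlocalMin.hasFDerivAt_eq_zero (hf₁.hasFDerivAt.sub_const (g z)).norm_sq)
  simp only [localRep_extChartAt, hru] at hzero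
  rw [real_inner_comm]
  simpa [localDeriv, inner_smul_left, hr] using hzero

theorem IsClosestPair.secondForm_le (hmin : IsClosestPair f₁ f₂ x y)
    (hf₁ : ContDiffAt ℝ 2 (localRep f₁ x) (extChartAt (𝓡 n) x x))
    (hf₂ : ContDiffAt ℝ 2 (localRep f₂ y) (extChartAt (𝓡 n) y y)) (hr : 0 < r)
    (hru : f₁ x - f₂ y = r • u) {v w : EuclideanSpace ℝ (Fin n)}
    (hvw : localDeriv f₁ x v = localDeriv f₂ y w) :
    secondForm f₁ u x v v ≤ secondForm f₂ u y w w := by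
  let G : ℝ → EuclideanSpace ℝ (Fin (n + 1)) := fun s =>
    localRep f₁ x (extChartAt (𝓡 n) x x + s • v) - localRep f₂ y (extChartAt (𝓡 n) y y + s • w)
  have hG0 : G 0 = f₁ x - f₂ y := by
    simp only [G, zero_smul, add_zero, localRep_extChartAt]
  have hlocalMin : IsLocalMin (fun s => ‖G s‖ ^ 2) 0 := Eventually.of_forall fun s => by
    simp only [hG0, ← dist_eq_norm]
    exact pow_le_pow_left₀ dist_nonneg ((hmin _ _).trans_eq (dist_eq_norm _ _)) 2
  have hG := (eventually_hasDerivAt_comp_add_smul hf₁ v).and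
    (eventually_hasDerivAt_comp_add_smul hf₂ w)
  have hvariation := norm_sq_add_inner_nonneg_of_isLocalMin (G := G)
    (hG.mono fun s hs => hs.1.sub hs.2)
    ((hasDerivAt_fderiv_comp_add_smul hf₁ v).sub (hasDerivAt_fderiv_comp_add_smul hf₂ w))
    hlocalMin
  have hvelocity : fderiv ℝ (localRep f₁ x) (extChartAt (𝓡 n) x x + (0 : ℝ) • v) v -
      fderiv ℝ (localRep f₂ y) (extChartAt (𝓡 n) y y + (0 : ℝ) • w) w = 0 := by
    simpa only [zero_smul, add_zero, sub_eq_zero, localDeriv] using hvw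
  rw [hvelocity, norm_zero, zero_pow two_ne_zero, zero_add, hG0, hru, real_inner_smul_left,
    inner_sub_right] at hvariation
  rw [secondForm, secondForm, neg_le_neg_iff, real_inner_comm, real_inner_comm u]
  exact sub_nonneg.1 (nonneg_of_mul_nonneg_right hvariation hr)

theorem IsClosestPair.principalCurvatures_le (hmin : IsClosestPair f₁ f₂ x y)
    (hf₁ : ContDiffAt ℝ 2 (localRep f₁ x) (extChartAt (𝓡 n) x x))
    (hf₂ : ContDiffAt ℝ 2 (localRep f₂ y) (extChartAt (𝓡 n) y y)) (hr : 0 < r)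
    (hru : f₁ x - f₂ y = r • u) (hu₁ : IsUnitNormal f₁ x u) (hu₂ : IsUnitNormal f₂ y u)
    {κ₁ κ₂ : Fin n → ℝ} (hκ₁ : IsPrincipalCurvatures f₁ u x κ₁)
    (hκ₂ : IsPrincipalCurvatures f₂ u y κ₂) (hmono₁ : Monotone κ₁) (hmono₂ : Monotone κ₂) :
    κ₁ ≤ κ₂ := by
  obtain ⟨a₁, ha₁⟩ := hκ₁.exists_orthonormalBasis hu₁
  obtain ⟨a₂, ha₂⟩ := hκ₂.exists_orthonormalBasis hu₂
  refine eigenvalues_le_of_quadraticForm_le a₁ a₂ hmono₁ hmono₂ fun w => ?_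
  obtain ⟨v₁, hv₁, hform₁⟩ := ha₁ w
  obtain ⟨v₂, hv₂, hform₂⟩ := ha₂ w
  rw [← hform₁, ← hform₂]
  exact hmin.secondForm_le hf₁ hf₂ hr hru (hv₁.trans hv₂.symm)

end ClosestPair

section SetDist

theorem setDist_range_le_setDist_range {α β E : Type*} [PseudoMetricSpace E] {f f' : α → E}
    {g g' : β → E} (h : ∀ x y, ∃ x' y', dist (f x') (g y') ≤ dist (f' x) (g' y)) :
    setDist (range f) (range g) ≤ setDist (range f') (range g') := by
  simp only [setDist, image2_range]
  change ⨅ p : α × β, dist (f p.1) (g p.2) ≤ ⨅ p : α × β, dist (f' p.1) (g' p.2)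
  rcases isEmpty_or_nonempty (α × β) with hempty | hnonempty
  · rw [Real.iInf_of_isEmpty, Real.iInf_of_isEmpty]
  refine le_ciInf fun p => ?_
  obtain ⟨x', y', hle⟩ := h p.1 p.2
  exact ciInf_le_of_le ⟨0, forall_mem_range.2 fun _ => dist_nonneg⟩ (x', y') hle

end SetDist

section Flow

variable {n : ℕ} {M : Type*} [TopologicalSpace M] [ChartedSpace (EuclideanSpace ℝ (Fin n)) M]
  {D : Set (Fin n → ℝ)} {F : (Fin n → ℝ) → ℝ} {I : Set ℝ}

/-- `X` is a `C²` solution of `∂X/∂t = -F ν` over the set `I` of times, differentiable in time at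
each point of `M`; compared with `IsSolution`, the velocity need not be continuous. The unit normal
is chosen separately at each point and time. -/
structure IsFlow (D : Set (Fin n → ℝ)) (F : (Fin n → ℝ) → ℝ) (I : Set ℝ)
    (X : M → ℝ → EuclideanSpace ℝ (Fin (n + 1))) : Prop where
  contMDiff : ∀ t ∈ I,
    ContMDiff (𝓡 n) 𝓘(ℝ, EuclideanSpace ℝ (Fin (n + 1))) 2 (fun x => X x t)
  continuousOn : ContinuousOn (fun p : M × ℝ => X p.1 p.2) (univ ×ˢ I)
  flow : ∀ t ∈ I, ∀ x : M, ∃ ν, IsUnitNormal (fun y => X y t) x ν ∧ ∃ κ ∈ D,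
    IsPrincipalCurvatures (fun y => X y t) ν x κ ∧ HasDerivWithinAt (X x) (-(F κ • ν)) I t

theorem IsSolution.isFlow {T : EReal} {X ν : M → ℝ → EuclideanSpace ℝ (Fin (n + 1))}
    (hX : IsSolution D F T X ν) : IsFlow D F (timeInterval T) X where
  contMDiff := hX.contMDiff
  continuousOn := hX.continuousOn
  flow t ht x := ⟨ν x t, hX.isUnitNormal t ht x, hX.flow t ht x⟩

theorem IsFlow.contDiffAt_localRep {X : M → ℝ → EuclideanSpace ℝ (Fin (n + 1))}
    (hX : IsFlow D F I X) {t : ℝ} (ht : t ∈ I) (x : M) :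
    ContDiffAt ℝ 2 (localRep (fun y => X y t) x) (extChartAt (𝓡 n) x x) :=
  CurvatureFlow.contDiffAt_localRep (hX.contMDiff t ht x)

/-- Oddness of `F` allows either unit normal, and symmetry allows the curvatures to be sorted. -/
theorem IsFlow.exists_monotone_curvatures {X : M → ℝ → EuclideanSpace ℝ (Fin (n + 1))}
    (hX : IsFlow D F I X) (hneg : ∀ κ ∈ D, -κ ∈ D)
    (hperm : ∀ σ : Equiv.Perm (Fin n), ∀ κ ∈ D, κ ∘ σ ∈ D) (hF : IsOddMonotoneSymmetric D F)
    {t : ℝ} (ht : t ∈ I) {x : M} {u : EuclideanSpace ℝ (Fin (n + 1))}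
    (hu : IsUnitNormal (fun y => X y t) x u) :
    ∃ κ ∈ D, Monotone κ ∧ IsPrincipalCurvatures (fun y => X y t) u x κ ∧
      HasDerivWithinAt (X x) (-(F κ • u)) I t := by
  obtain ⟨ν, hν, κ, hκD, hκ, hderiv⟩ := hX.flow t ht x
  obtain ⟨μ, hμD, hμ, hderiv⟩ : ∃ μ ∈ D, IsPrincipalCurvatures (fun y => X y t) u x μ ∧
      HasDerivWithinAt (X x) (-(F μ • u)) I t := by
    rcases hν.eq_or_eq_neg hκ hu with rfl | rfl
    · exact ⟨κ, hκD, hκ, hderiv⟩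
    · exact ⟨-κ, hneg κ hκD, hκ.neg, by rwa [hF.odd κ hκD, neg_smul_neg]⟩
  exact ⟨μ ∘ Tuple.sort μ, hperm _ μ hμD, Tuple.monotone_sort μ, hμ.comp_perm _,
    by rwa [hF.symm _ μ hμD]⟩

variable {M₁ M₂ : Type*}
  [TopologicalSpace M₁] [ChartedSpace (EuclideanSpace ℝ (Fin n)) M₁]
  [TopologicalSpace M₂] [ChartedSpace (EuclideanSpace ℝ (Fin n)) M₂]
  {X₁ : M₁ → ℝ → EuclideanSpace ℝ (Fin (n + 1))} {X₂ : M₂ → ℝ → EuclideanSpace ℝ (Fin (n + 1))}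

theorem IsClosestPair.exists_velocity_inner_nonneg {t : ℝ} {x : M₁} {y : M₂}
    (hmin : IsClosestPair (fun z => X₁ z t) (fun z => X₂ z t) x y)
    (hneg : ∀ κ ∈ D, -κ ∈ D) (hperm : ∀ σ : Equiv.Perm (Fin n), ∀ κ ∈ D, κ ∘ σ ∈ D)
    (hF : IsOddMonotoneSymmetric D F) (h₁ : IsFlow D F I X₁) (h₂ : IsFlow D F I X₂) (ht : t ∈ I) :
    ∃ V₁ V₂, HasDerivWithinAt (X₁ x) V₁ I t ∧ HasDerivWithinAt (X₂ y) V₂ I t ∧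
      0 ≤ ⟪X₁ x t - X₂ y t, V₁ - V₂⟫ := by
  rcases eq_or_ne (X₁ x t - X₂ y t) 0 with hzero | hne
  · obtain ⟨_, -, _, -, -, hderiv₁⟩ := h₁.flow t ht x
    obtain ⟨_, -, _, -, -, hderiv₂⟩ := h₂.flow t ht y
    exact ⟨_, _, hderiv₁, hderiv₂, by rw [hzero, inner_zero_left]⟩
  obtain ⟨r, u, hr, hu, hru⟩ : ∃ (r : ℝ) (u : EuclideanSpace ℝ (Fin (n + 1))),
      0 < r ∧ ‖u‖ = 1 ∧ X₁ x t - X₂ y t = r • u :=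
    ⟨_, _, norm_pos_iff.2 hne, norm_smul_inv_norm (𝕜 := ℝ) hne,
      (smul_inv_smul₀ (norm_ne_zero_iff.2 hne) _).symm⟩
  have hf₁ := h₁.contDiffAt_localRep ht x
  have hf₂ := h₂.contDiffAt_localRep ht y
  have hu₁ : IsUnitNormal (fun z => X₁ z t) x u :=
    hmin.isUnitNormal_left (hf₁.differentiableAt two_ne_zero) hr.ne' hu hru
  have hu₂ : IsUnitNormal (fun z => X₂ z t) y u :=
    hmin.symm.isUnitNormal_left (hf₂.differentiableAt two_ne_zero) (neg_ne_zero.2 hr.ne') hu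
      (by rw [neg_smul, ← hru, neg_sub])
  obtain ⟨κ₁, hκ₁D, hmono₁, hκ₁, hderiv₁⟩ := h₁.exists_monotone_curvatures hneg hperm hF ht hu₁
  obtain ⟨κ₂, hκ₂D, hmono₂, hκ₂, hderiv₂⟩ := h₂.exists_monotone_curvatures hneg hperm hF ht hu₂
  have hκ_le : κ₁ ≤ κ₂ :=
    hmin.principalCurvatures_le hf₁ hf₂ hr hru hu₁ hu₂ hκ₁ hκ₂ hmono₁ hmono₂
  have hF_le : F κ₁ ≤ F κ₂ := hF.mono hκ₁D hκ₂D hκ_le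
  refine ⟨_, _, hderiv₁, hderiv₂, ?_⟩
  calc 0 ≤ r * (F κ₂ - F κ₁) := mul_nonneg hr.le (sub_nonneg.2 hF_le)
    _ = ⟪r • u, -(F κ₁ • u) - -(F κ₂ • u)⟫ := by
      rw [neg_sub_neg, ← sub_smul, real_inner_smul_left, real_inner_smul_right,
        real_inner_self_eq_norm_sq, hu, one_pow, mul_one]
    _ = ⟪X₁ x t - X₂ y t, -(F κ₁ • u) - -(F κ₂ • u)⟫ := by rw [hru]

theorem IsFlow.exists_dist_le [CompactSpace M₁] [CompactSpace M₂] [I.OrdConnected]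
    (hneg : ∀ κ ∈ D, -κ ∈ D) (hperm : ∀ σ : Equiv.Perm (Fin n), ∀ κ ∈ D, κ ∘ σ ∈ D)
    (hF : IsOddMonotoneSymmetric D F) (h₁ : IsFlow D F I X₁) (h₂ : IsFlow D F I X₂) {a b : ℝ}
    (ha : a ∈ I) (hb : b ∈ I) (hab : a ≤ b) (x : M₁) (y : M₂) :
    ∃ x' y', dist (X₁ x' a) (X₂ y' a) ≤ dist (X₁ x b) (X₂ y b) := by
  have hsub : Icc a b ⊆ I := I.Icc_subset ha hb
  have hcont₁ : ContinuousOn (fun z : (M₁ × M₂) × ℝ => X₁ z.1.1 z.2) (univ ×ˢ Icc a b) :=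
    h₁.continuousOn.comp (f := fun z : (M₁ × M₂) × ℝ => (z.1.1, z.2)) (by fun_prop)
      fun z hz => ⟨mem_univ _, hsub hz.2⟩
  have hcont₂ : ContinuousOn (fun z : (M₁ × M₂) × ℝ => X₂ z.1.2 z.2) (univ ×ˢ Icc a b) :=
    h₂.continuousOn.comp (f := fun z : (M₁ × M₂) × ℝ => (z.1.2, z.2)) (by fun_prop)
      fun z hz => ⟨mem_univ _, hsub hz.2⟩
  obtain ⟨p, hp⟩ := exists_le_of_deriv_nonneg_at_min (K := M₁ × M₂)
    (q := fun p t => ‖X₁ p.1 t - X₂ p.2 t‖ ^ 2) hab ((hcont₁.sub hcont₂).norm.pow 2)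
    (fun t ht p hp => by
      have hclosest : IsClosestPair (fun z => X₁ z t) (fun z => X₂ z t) p.1 p.2 := fun x' y' => by
        simpa only [dist_eq_norm] using le_of_sq_le_sq (hp (x', y')) (norm_nonneg _)
      obtain ⟨V₁, V₂, hderiv₁, hderiv₂, hinner⟩ := hclosest.exists_velocity_inner_nonneg
        hneg hperm hF h₁ h₂ (hsub (Ioc_subset_Icc_self ht))
      exact ⟨_, mul_nonneg zero_le_two hinner,
        (hderiv₁.sub hderiv₂).norm_sq.mono_of_mem_nhdsWithin
          (mem_of_superset (Icc_mem_nhdsLT_of_mem ht) hsub)⟩)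
    (x, y)
  simp only [← dist_eq_norm] at hp
  exact ⟨p.1, p.2, le_of_sq_le_sq hp dist_nonneg⟩

end Flow

section TimeInterval

variable {T : EReal}

instance ordConnected_timeInterval : (timeInterval T).OrdConnected :=
  ⟨fun _ ha _ hb _ ht => ⟨ha.1.trans ht.1, (EReal.coe_le_coe_iff.2 ht.2).trans_lt hb.2⟩⟩

theorem zero_mem_timeInterval {t : ℝ} (ht : t ∈ timeInterval T) : 0 ∈ timeInterval T :=
  ⟨le_rfl, (EReal.coe_le_coe_iff.2 ht.1).trans_lt ht.2⟩

end TimeInterval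

section SymmetricCone

variable {n : ℕ} {Γ : Set (Fin n → ℝ)}

theorem neg_mem_union_neg {κ : Fin n → ℝ} (hκ : κ ∈ Γ ∪ {κ | -κ ∈ Γ}) :
    -κ ∈ Γ ∪ {κ | -κ ∈ Γ} :=
  hκ.symm.imp_right fun h => show - -κ ∈ Γ by rwa [neg_neg]

theorem IsSymmetricCone.comp_perm_mem_union_neg (hΓ : IsSymmetricCone Γ)
    (σ : Equiv.Perm (Fin n)) {κ : Fin n → ℝ} (hκ : κ ∈ Γ ∪ {κ | -κ ∈ Γ}) :
    κ ∘ σ ∈ Γ ∪ {κ | -κ ∈ Γ} :=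
  hκ.imp (hΓ.perm_mem σ κ) (hΓ.perm_mem σ (-κ))

end SymmetricCone

end CurvatureFlow

theorem mainTheorem3_general {n : ℕ} {D : Set (Fin n → ℝ)} (hneg : ∀ κ ∈ D, -κ ∈ D)
    (hperm : ∀ σ : Equiv.Perm (Fin n), ∀ κ ∈ D, κ ∘ σ ∈ D) {F : (Fin n → ℝ) → ℝ}
    (hF : CurvatureFlow.IsOddMonotoneSymmetric D F)
    {M₁ : Type*} [TopologicalSpace M₁] [CompactSpace M₁]
    [ChartedSpace (EuclideanSpace ℝ (Fin n)) M₁]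
    {M₂ : Type*} [TopologicalSpace M₂] [CompactSpace M₂]
    [ChartedSpace (EuclideanSpace ℝ (Fin n)) M₂]
    {I : Set ℝ} [I.OrdConnected]
    {X₁ : M₁ → ℝ → EuclideanSpace ℝ (Fin (n + 1))} {X₂ : M₂ → ℝ → EuclideanSpace ℝ (Fin (n + 1))}
    (h₁ : CurvatureFlow.IsFlow D F I X₁) (h₂ : CurvatureFlow.IsFlow D F I X₂) :
    MonotoneOn
      (fun t => CurvatureFlow.setDist (Set.range fun x => X₁ x t) (Set.range fun y => X₂ y t)) I ∧
    ∀ a ∈ I, ∀ b ∈ I, a ≤ b →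
      Disjoint (Set.range fun x => X₁ x a) (Set.range fun y => X₂ y a) →
      Disjoint (Set.range fun x => X₁ x b) (Set.range fun y => X₂ y b) := by
  refine ⟨fun a ha b hb hab => CurvatureFlow.setDist_range_le_setDist_range
    (h₁.exists_dist_le hneg hperm hF h₂ ha hb hab), fun a ha b hb hab hdisj => ?_⟩
  simp only [Set.disjoint_range_iff] at hdisj ⊢
  intro x y hxy
  obtain ⟨x', y', hle⟩ := h₁.exists_dist_le hneg hperm hF h₂ ha hb hab x y
  rw [hxy, dist_self] at hle
  exact hdisj x' y' (dist_le_zero.1 hle)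

theorem mainTheorem3 {n : ℕ}
    (Γ : Set (Fin n → ℝ)) (hΓ : CurvatureFlow.IsSymmetricCone Γ)
    (F : (Fin n → ℝ) → ℝ)
    (hF : CurvatureFlow.IsOddMonotoneSymmetric (Γ ∪ {κ | -κ ∈ Γ}) F)
    {M₁ : Type*} [TopologicalSpace M₁] [T2Space M₁] [CompactSpace M₁]
    [ChartedSpace (EuclideanSpace ℝ (Fin n)) M₁] [IsManifold (𝓡 n) ∞ M₁]
    {M₂ : Type*} [TopologicalSpace M₂] [T2Space M₂] [CompactSpace M₂]
    [ChartedSpace (EuclideanSpace ℝ (Fin n)) M₂] [IsManifold (𝓡 n) ∞ M₂]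
    (T : EReal)
    (X₁ ν₁ : M₁ → ℝ → EuclideanSpace ℝ (Fin (n + 1)))
    (X₂ ν₂ : M₂ → ℝ → EuclideanSpace ℝ (Fin (n + 1)))
    (h₁ : CurvatureFlow.IsSolution (Γ ∪ {κ | -κ ∈ Γ}) F T X₁ ν₁)
    (h₂ : CurvatureFlow.IsSolution (Γ ∪ {κ | -κ ∈ Γ}) F T X₂ ν₂)
    (hdisj : Disjoint (Set.range fun x => X₁ x 0) (Set.range fun y => X₂ y 0)) :
    MonotoneOn
      (fun t => CurvatureFlow.setDist (Set.range fun x => X₁ x t) (Set.range fun y => X₂ y t))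
      (CurvatureFlow.timeInterval T) ∧
    ∀ t ∈ CurvatureFlow.timeInterval T,
      Disjoint (Set.range fun x => X₁ x t) (Set.range fun y => X₂ y t) := by
  have hmono := mainTheorem3_general (fun _ => CurvatureFlow.neg_mem_union_neg)
    (fun σ _ => hΓ.comp_perm_mem_union_neg σ) hF h₁.isFlow h₂.isFlow
  exact ⟨hmono.1, fun t ht =>
    hmono.2 0 (CurvatureFlow.zero_mem_timeInterval ht) t ht ht.1 hdisj⟩
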